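/- Let $\mathbb{H}$ be the Heisenberg group, i.e. the simply connected $3$-dimensional Lie group whose Lie algebra has a basis $\xi,\eta,\zeta$ with $[\xi,\eta]=\zeta$ and $\zeta$ central. Let $d$ be its Carnot distance: $d(x,x')$ is the infimum of the lengths of the curves joining $x$ to $x'$ that are tangent to the plane field spanned by the left-invariant vector fields $\xi$ and $\eta$, lengths being measured with the metric in which $(\xi,\eta)$ is orthonormal. Let $V$ be a real Banach space with the Radon–Nikodym property: for every finite measure space $(\Omega,\Sigma,\mu)$, every countably additive vector measure $\nu:\Sigma\to V$ of bounded variation that vanishes on the $\mu$-null sets is of the form $\nu(E)=\int_E g\,d\mu$ for some Bochner integrable $g:\Omega\to V$. Then $(\mathbb{H},d)$ does not embed bi-Lipschitzly into $V$: there is no map $f:\mathbb{H}\to V$ for which there exist constants $c>0$ and $C<\infty$ with $$c\,d(x,x')\le\|f(x)-f(x')\|\le C\,d(x,x')\qquad\text{for all }x,x'\in\mathbb{H}.$$ -/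

import Mathlib

open MeasureTheory Set
open scoped NNReal ENNReal

noncomputable section

/-- The Heisenberg group in exponential coordinates of the first kind: the point with coordinates
`(x, y, z)` is `exp (x ξ + y η + z ζ)`, where `[ξ, η] = ζ` and `ζ` is central. -/
@[ext]
structure Heisenberg where
  x : ℝ
  y : ℝ
  z : ℝ

namespace Heisenberg

instance : Mul Heisenberg :=
  ⟨fun p q => ⟨p.x + q.x, p.y + q.y, p.z + q.z + (p.x * q.y - p.y * q.x) / 2⟩⟩

instance : One Heisenberg := ⟨⟨0, 0, 0⟩⟩

instance : Inv Heisenberg := ⟨fun p => ⟨-p.x, -p.y, -p.z⟩⟩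

@[simp] theorem mul_x (p q : Heisenberg) : (p * q).x = p.x + q.x := rfl
@[simp] theorem mul_y (p q : Heisenberg) : (p * q).y = p.y + q.y := rfl
@[simp] theorem mul_z (p q : Heisenberg) :
    (p * q).z = p.z + q.z + (p.x * q.y - p.y * q.x) / 2 := rfl
@[simp] theorem one_x : (1 : Heisenberg).x = 0 := rfl
@[simp] theorem one_y : (1 : Heisenberg).y = 0 := rfl
@[simp] theorem one_z : (1 : Heisenberg).z = 0 := rfl
@[simp] theorem inv_x (p : Heisenberg) : p⁻¹.x = -p.x := rfl
@[simp] theorem inv_y (p : Heisenberg) : p⁻¹.y = -p.y := rfl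
@[simp] theorem inv_z (p : Heisenberg) : p⁻¹.z = -p.z := rfl

instance : Group Heisenberg :=
  Group.ofLeftAxioms
    (fun p q r => by ext <;> simp <;> ring)
    (fun p => by ext <;> simp)
    (fun p => by ext <;> simp; ring)

/-- The global chart identifying the group with `ℝ³` as a smooth manifold; all the tangent spaces
are identified with `ℝ³` through it. -/
def coords : Heisenberg ≃ ℝ × ℝ × ℝ where
  toFun p := (p.x, p.y, p.z)
  invFun v := ⟨v.1, v.2.1, v.2.2⟩
  left_inv _ := rfl
  right_inv _ := rfl

/-- The left-invariant vector field `ξ`, in the chart. -/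
def xi (p : Heisenberg) : ℝ × ℝ × ℝ := (1, 0, -p.y / 2)

/-- The left-invariant vector field `η`, in the chart. -/
def eta (p : Heisenberg) : ℝ × ℝ × ℝ := (0, 1, p.x / 2)

/-- The left-invariant vector field `ζ`, in the chart. -/
def zeta (_ : Heisenberg) : ℝ × ℝ × ℝ := (0, 0, 1)

/-- `ξ` is the left-invariant field generating the one-parameter group `t ↦ (t, 0, 0)`. -/
theorem hasDerivAt_xi (p : Heisenberg) :
    HasDerivAt (fun t : ℝ => coords (p * ⟨t, 0, 0⟩)) (xi p) 0 := by
  have h := ((hasDerivAt_id (0 : ℝ)).const_add p.x).prodMk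
    ((hasDerivAt_const (0 : ℝ) p.y).prodMk
      (((hasDerivAt_id (0 : ℝ)).mul_const (-p.y / 2)).const_add p.z))
  convert h using 1
  · funext t
    simp only [coords, Equiv.coe_fn_mk, mul_x, mul_y, mul_z, id]
    ext <;> simp; ring
  · simp [xi]

/-- `η` is the left-invariant field generating the one-parameter group `t ↦ (0, t, 0)`. -/
theorem hasDerivAt_eta (p : Heisenberg) :
    HasDerivAt (fun t : ℝ => coords (p * ⟨0, t, 0⟩)) (eta p) 0 := by
  have h := (hasDerivAt_const (0 : ℝ) p.x).prodMk
    (((hasDerivAt_id (0 : ℝ)).const_add p.y).prodMk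
      (((hasDerivAt_id (0 : ℝ)).mul_const (p.x / 2)).const_add p.z))
  convert h using 1
  · funext t
    simp only [coords, Equiv.coe_fn_mk, mul_x, mul_y, mul_z, id]
    ext <;> simp; ring
  · simp [eta]

/-- The bracket relation `[ξ, η] = ζ`. -/
theorem lieBracket_xi_eta (v : ℝ × ℝ × ℝ) :
    VectorField.lieBracket ℝ (fun w => xi (coords.symm w)) (fun w => eta (coords.symm w)) v =
      zeta (coords.symm v) := by
  let A : ℝ × ℝ × ℝ →L[ℝ] ℝ × ℝ × ℝ :=
    (0 : ℝ × ℝ × ℝ →L[ℝ] ℝ).prod ((0 : ℝ × ℝ × ℝ →L[ℝ] ℝ).prod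
      ((-1 / 2 : ℝ) • (ContinuousLinearMap.fst ℝ ℝ ℝ).comp (ContinuousLinearMap.snd ℝ ℝ (ℝ × ℝ))))
  let B : ℝ × ℝ × ℝ →L[ℝ] ℝ × ℝ × ℝ :=
    (0 : ℝ × ℝ × ℝ →L[ℝ] ℝ).prod ((0 : ℝ × ℝ × ℝ →L[ℝ] ℝ).prod
      ((1 / 2 : ℝ) • ContinuousLinearMap.fst ℝ ℝ (ℝ × ℝ)))
  have hA : (fun w => xi (coords.symm w)) = fun w => ((1, 0, 0) : ℝ × ℝ × ℝ) + A w := by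
    funext w
    ext <;> simp [xi, coords, A]; ring
  have hB : (fun w => eta (coords.symm w)) = fun w => ((0, 1, 0) : ℝ × ℝ × ℝ) + B w := by
    funext w
    ext <;> simp [eta, coords, B]; ring
  have hA' : fderiv ℝ (fun w => xi (coords.symm w)) v = A := by
    rw [hA]; exact (A.hasFDerivAt.const_add _).fderiv
  have hB' : fderiv ℝ (fun w => eta (coords.symm w)) v = B := by
    rw [hB]; exact (B.hasFDerivAt.const_add _).fderiv
  rw [VectorField.lieBracket, hA', hB']
  ext <;> simp [xi, eta, zeta, A, B]
  norm_num

/-- `γ`, restricted to `[0, 1]`, is a `C¹` curve tangent to the plane field spanned by `ξ` and `η`,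
with velocity `γ'(t) = a(t) ξ(γ(t)) + b(t) η(γ(t))`. -/
structure IsHorizontalCurve (γ : ℝ → Heisenberg) (a b : ℝ → ℝ) : Prop where
  continuousOn_fst : ContinuousOn a (Icc 0 1)
  continuousOn_snd : ContinuousOn b (Icc 0 1)
  hasDerivWithinAt : ∀ t ∈ Icc (0 : ℝ) 1,
    HasDerivWithinAt (fun s => coords (γ s)) (a t • xi (γ t) + b t • eta (γ t)) (Icc 0 1) t

/-- The length of a horizontal curve with velocity `a ξ + b η`, for the metric on the horizontal
planes in which `(ξ, η)` is orthonormal. -/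
def horizontalLength (a b : ℝ → ℝ) : ℝ≥0∞ :=
  ∫⁻ t in Icc (0 : ℝ) 1, ENNReal.ofReal (√(a t ^ 2 + b t ^ 2))

/-- The Carnot distance: the infimum of the lengths of the horizontal curves joining `p` to `q`
(it would be `∞` if there were none). -/
def carnotDist (p q : Heisenberg) : ℝ≥0∞ :=
  ⨅ (γ : ℝ → Heisenberg) (a : ℝ → ℝ) (b : ℝ → ℝ)
    (_ : IsHorizontalCurve γ a b ∧ γ 0 = p ∧ γ 1 = q), horizontalLength a b

/-- `f` is a bi-Lipschitz embedding of the Heisenberg group, with its Carnot distance, into `V`. -/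
def IsBilipschitzEmbedding {V : Type*} [PseudoEMetricSpace V] (f : Heisenberg → V) : Prop :=
  ∃ c C : ℝ≥0, 0 < c ∧ ∀ p q : Heisenberg,
    c * carnotDist p q ≤ edist (f p) (f q) ∧ edist (f p) (f q) ≤ C * carnotDist p q

end Heisenberg

/-- The Radon-Nikodym property: a `V`-valued countably additive measure of bounded variation on a
finite measure space `(Ω, μ)` that vanishes on the `μ`-null sets has a Bochner integrable density
with respect to `μ`. -/
def HasRadonNikodymProperty (V : Type*) [NormedAddCommGroup V] [NormedSpace ℝ V] : Prop :=
  ∀ (Ω : Type) [MeasurableSpace Ω] (μ : Measure Ω) [IsFiniteMeasure μ] (ν : VectorMeasure Ω V),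
    ν.variation univ < ∞ →
    (∀ s, MeasurableSet s → μ s = 0 → ν s = 0) →
    ∃ g : Ω → V, Integrable g μ ∧ ∀ s, MeasurableSet s → ν s = ∫ ω in s, g ω ∂μ

end

/-! Suppose `f` is bi-Lipschitz and let `F` be `f` in the chart. The Radon–Nikodym property makes
Lipschitz curves differentiable almost everywhere. By Fubini along the flow of a unit horizontal
field, the difference quotients of `F` with step `s = 1 / (n + 1)` therefore converge at almost
every point (`ae_cauchySeq_horQuotient`). They are also bounded by `C`, so composing them with right
translations that tend to the identity changes them by `o(1)` in `L¹` of a box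
(`tendsto_lintegral_enorm_comp_sub`).

The `ξ`-`η` quadrilateral of side `s` closes up to the vertical translation by `s ^ 2`. Since
opposite sides nearly cancel, the vertical increment of `F` divided by `s` is a combination of three
such changes (`smul_vertical_sub_eq`) and tends to `0` in `L¹`. But `s ^ 2` units of height cost
Carnot distance at least `s` (`ofReal_le_carnotDist`), so this quotient has norm at least `c`
everywhere: a contradiction. The limits of the quotients are never identified; being Cauchy is
enough. -/

open Filter Topology

/-! ### Estimates for the Carnot distance; continuity of Lipschitz maps in the chart. -/

namespace Heisenberg

/-- A function on `[0, 1]` whose derivative is bounded by `w` moves by at most `∫ w`. -/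
theorem abs_sub_le_integral_of_abs_deriv_le {g g' w : ℝ → ℝ}
    (hg : ∀ t ∈ Icc (0 : ℝ) 1, HasDerivWithinAt g (g' t) (Icc 0 1) t)
    (hg' : ContinuousOn g' (Icc 0 1)) (hw : ContinuousOn w (Icc 0 1))
    (h : ∀ t ∈ Icc (0 : ℝ) 1, |g' t| ≤ w t) {t : ℝ} (ht : t ∈ Icc (0 : ℝ) 1) :
    |g t - g 0| ≤ ∫ s in (0 : ℝ)..1, w s := by
  have hsub : Icc 0 t ⊆ Icc (0 : ℝ) 1 := Icc_subset_Icc_right ht.2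
  have hint : IntervalIntegrable g' volume 0 t :=
    (hg'.mono (by rwa [uIcc_of_le ht.1])).intervalIntegrable
  have hwint : IntervalIntegrable w volume 0 1 :=
    (hw.mono (by rw [uIcc_of_le zero_le_one])).intervalIntegrable
  have key : ∫ s in (0 : ℝ)..t, g' s = g t - g 0 := by
    refine intervalIntegral.integral_eq_sub_of_hasDerivAt_of_le ht.1
      (fun s hs => ((hg s (hsub hs)).mono hsub).continuousWithinAt) (fun s hs => ?_) hint
    exact (hg s (hsub (Ioo_subset_Icc_self hs))).hasDerivAt
      (Icc_mem_nhds hs.1 (hs.2.trans_le ht.2))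
  rw [← key]
  calc |∫ s in (0 : ℝ)..t, g' s| ≤ ∫ s in (0 : ℝ)..t, |g' s| :=
        intervalIntegral.abs_integral_le_integral_abs ht.1
    _ ≤ ∫ s in (0 : ℝ)..t, w s :=
        intervalIntegral.integral_mono_on ht.1 hint.abs
          (hwint.mono_set (by rw [uIcc_of_le ht.1, uIcc_of_le zero_le_one]; exact hsub))
          (fun s hs => h s (hsub hs))
    _ ≤ ∫ s in (0 : ℝ)..1, w s := by
        refine intervalIntegral.integral_mono_interval le_rfl ht.1 ht.2 ?_ hwint
        filter_upwards [ae_restrict_mem measurableSet_Ioc] with s hs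
        exact (abs_nonneg _).trans (h s (Ioc_subset_Icc_self hs))

/-- The length of a horizontal curve with vertical displacement `s ^ 2` is at least `s`. -/
theorem IsHorizontalCurve.ofReal_le_horizontalLength {γ : ℝ → Heisenberg} {a b : ℝ → ℝ}
    (hγ : IsHorizontalCurve γ a b) {p : Heisenberg} {s : ℝ}
    (h0 : γ 0 = p) (h1 : γ 1 = p * ⟨0, 0, s ^ 2⟩) :
    ENNReal.ofReal s ≤ horizontalLength a b := by
  have ha := hγ.continuousOn_fst
  have hb := hγ.continuousOn_snd
  have hx : ∀ t ∈ Icc (0 : ℝ) 1, HasDerivWithinAt (fun s => (γ s).x) (a t) (Icc 0 1) t := by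
    intro t ht
    simpa [xi, eta, coords, Function.comp_def] using
      (ContinuousLinearMap.fst ℝ ℝ (ℝ × ℝ)).hasFDerivAt.comp_hasDerivWithinAt t
        (hγ.hasDerivWithinAt t ht)
  have hy : ∀ t ∈ Icc (0 : ℝ) 1, HasDerivWithinAt (fun s => (γ s).y) (b t) (Icc 0 1) t := by
    intro t ht
    simpa [xi, eta, coords, Function.comp_def] using
      ((ContinuousLinearMap.fst ℝ ℝ ℝ).comp
        (ContinuousLinearMap.snd ℝ ℝ (ℝ × ℝ))).hasFDerivAt.comp_hasDerivWithinAt t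
          (hγ.hasDerivWithinAt t ht)
  have hz : ∀ t ∈ Icc (0 : ℝ) 1, HasDerivWithinAt (fun s => (γ s).z)
      (a t * (-(γ t).y / 2) + b t * ((γ t).x / 2)) (Icc 0 1) t := by
    intro t ht
    simpa [xi, eta, coords, Function.comp_def] using
      ((ContinuousLinearMap.snd ℝ ℝ ℝ).comp
        (ContinuousLinearMap.snd ℝ ℝ (ℝ × ℝ))).hasFDerivAt.comp_hasDerivWithinAt t
          (hγ.hasDerivWithinAt t ht)
  set w : ℝ → ℝ := fun t => √(a t ^ 2 + b t ^ 2) with hw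
  have hwc : ContinuousOn w (Icc 0 1) := ((ha.pow 2).add (hb.pow 2)).sqrt
  have haw : ∀ t, |a t| ≤ w t := fun t => Real.abs_le_sqrt (by nlinarith [sq_nonneg (b t)])
  have hbw : ∀ t, |b t| ≤ w t := fun t => Real.abs_le_sqrt (by nlinarith [sq_nonneg (a t)])
  set l := ∫ t in (0 : ℝ)..1, w t with hl
  have hlen : horizontalLength a b = ENNReal.ofReal l := by
    rw [horizontalLength, hl, intervalIntegral.integral_of_le zero_le_one,
      ← integral_Icc_eq_integral_Ioc,
      ofReal_integral_eq_lintegral_ofReal (hwc.integrableOn_compact isCompact_Icc)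
        (ae_of_all _ fun t => Real.sqrt_nonneg _)]
  have hl0 : 0 ≤ l := intervalIntegral.integral_nonneg zero_le_one fun t _ => Real.sqrt_nonneg _
  have hxl : ∀ t ∈ Icc (0 : ℝ) 1, |(γ t).x - p.x| ≤ l := by
    intro t ht
    simpa [h0] using abs_sub_le_integral_of_abs_deriv_le hx ha hwc (fun t _ => haw t) ht
  have hyl : ∀ t ∈ Icc (0 : ℝ) 1, |(γ t).y - p.y| ≤ l := by
    intro t ht
    simpa [h0] using abs_sub_le_integral_of_abs_deriv_le hy hb hwc (fun t _ => hbw t) ht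
  -- Up to a constant, `g` is the height of `p⁻¹ * γ`, the curve translated to start at the
  -- identity. Its derivative involves only displacements from `p`, each at most `l`, so the total
  -- height is at most `l ^ 2`.
  have hrel := abs_sub_le_integral_of_abs_deriv_le
    (g := fun t => (γ t).z - (p.x * (γ t).y - p.y * (γ t).x) / 2)
    (g' := fun t => (b t * ((γ t).x - p.x) - a t * ((γ t).y - p.y)) / 2)
    (w := fun t => l * w t)
    (fun t ht => by
      refine ((hz t ht).sub ((((hy t ht).const_mul p.x).sub
        ((hx t ht).const_mul p.y)).div_const 2)).congr_deriv ?_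
      ring)
    (((hb.mul ((fun t ht => (hx t ht).continuousWithinAt.sub continuousWithinAt_const))).sub
      (ha.mul ((fun t ht => (hy t ht).continuousWithinAt.sub continuousWithinAt_const)))).div_const
        2)
    (hwc.const_mul l)
    (fun t ht => by
      have e1 : |b t * ((γ t).x - p.x)| ≤ w t * l := by
        rw [abs_mul]; exact mul_le_mul (hbw t) (hxl t ht) (abs_nonneg _) (Real.sqrt_nonneg _)
      have e2 : |a t * ((γ t).y - p.y)| ≤ w t * l := by
        rw [abs_mul]; exact mul_le_mul (haw t) (hyl t ht) (abs_nonneg _) (Real.sqrt_nonneg _)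
      rw [abs_le] at e1 e2 ⊢
      constructor <;> linarith [e1.1, e1.2, e2.1, e2.2])
    (right_mem_Icc.2 zero_le_one)
  rw [intervalIntegral.integral_const_mul, ← hl, h0, h1] at hrel
  have hsl : s ^ 2 ≤ l ^ 2 := by
    have := (le_abs_self _).trans hrel
    simp only [mul_x, mul_y, mul_z] at this
    nlinarith
  rw [hlen]
  exact ENNReal.ofReal_le_ofReal (abs_le_of_sq_le_sq' hsl hl0).2

theorem ofReal_le_carnotDist (p : Heisenberg) (s : ℝ) :
    ENNReal.ofReal s ≤ carnotDist p (p * ⟨0, 0, s ^ 2⟩) := by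
  simp only [carnotDist, le_iInf_iff]
  rintro γ a b ⟨hγ, h0, h1⟩
  exact hγ.ofReal_le_horizontalLength h0 h1

/-- The horizontal element `exp (u ξ + v η)`. -/
def hor (u v : ℝ) : Heisenberg := ⟨u, v, 0⟩

@[simp] theorem hor_x (u v : ℝ) : (hor u v).x = u := rfl
@[simp] theorem hor_y (u v : ℝ) : (hor u v).y = v := rfl
@[simp] theorem hor_z (u v : ℝ) : (hor u v).z = 0 := rfl

/-- The translate by `p` of a one-parameter subgroup in a horizontal direction is a horizontal curve
of constant velocity. -/
theorem carnotDist_mul_hor_le (p : Heisenberg) (u v : ℝ) :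
    carnotDist p (p * hor u v) ≤ ENNReal.ofReal √(u ^ 2 + v ^ 2) := by
  have hγ : IsHorizontalCurve (fun t => p * hor (t * u) (t * v)) (fun _ => u) (fun _ => v) := by
    refine ⟨continuousOn_const, continuousOn_const, fun t _ => ?_⟩
    have h := (((hasDerivAt_id t).mul_const u).const_add p.x).prodMk
      ((((hasDerivAt_id t).mul_const v).const_add p.y).prodMk
        (((hasDerivAt_id t).mul_const ((p.x * v - p.y * u) / 2)).const_add p.z))
    have hfun : (fun t => coords (p * hor (t * u) (t * v))) = fun t =>
        (p.x + id t * u, p.y + id t * v, p.z + id t * ((p.x * v - p.y * u) / 2)) := by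
      funext t
      simp only [coords, Equiv.coe_fn_mk, mul_x, mul_y, mul_z, id, hor_x, hor_y, hor_z]
      ext <;> simp; ring
    rw [hfun]
    refine (h.congr_deriv ?_).hasDerivWithinAt
    ext <;> simp [xi, eta]; ring
  have h01 : p * hor (0 * u) (0 * v) = p ∧ p * hor (1 * u) (1 * v) = p * hor u v := by
    constructor <;> ext <;> simp
  calc carnotDist p (p * hor u v) ≤ horizontalLength (fun _ => u) (fun _ => v) :=
        iInf_le_of_le _ (iInf_le_of_le _ (iInf_le_of_le _ (iInf_le _ (And.intro hγ h01))))
    _ = ENNReal.ofReal √(u ^ 2 + v ^ 2) := by simp [horizontalLength]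

/-- Horizontal translations move a Lipschitz map by at most `C` times their length. -/
theorem norm_sub_le_of_edist_le {V : Type*} [NormedAddCommGroup V] {f : Heisenberg → V} {C : ℝ≥0}
    (hf : ∀ p q, edist (f p) (f q) ≤ C * carnotDist p q) (p : Heisenberg) (u v : ℝ) :
    ‖f (p * hor u v) - f p‖ ≤ C * √(u ^ 2 + v ^ 2) := by
  have h := (hf p (p * hor u v)).trans (mul_le_mul_right (carnotDist_mul_hor_le p u v) _)
  rw [edist_comm, edist_dist, dist_eq_norm, ← ENNReal.ofReal_coe_nnreal,
    ← ENNReal.ofReal_mul C.coe_nonneg] at h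
  exact (ENNReal.ofReal_le_ofReal_iff (by positivity)).1 h

/-- A Lipschitz map is continuous for the topology of the chart. -/
theorem continuous_comp_coords_symm {V : Type*} [NormedAddCommGroup V] {f : Heisenberg → V}
    {C : ℝ≥0} (hf : ∀ p q, edist (f p) (f q) ≤ C * carnotDist p q) :
    Continuous fun w => f (coords.symm w) := by
  have step := norm_sub_le_of_edist_le hf
  have vert : ∀ (p : Heisenberg) (r : ℝ), ‖f (p * ⟨0, 0, r⟩) - f p‖ ≤ 4 * C * √|r| := by
    intro p r
    -- The commutator of `exp (a ξ)` and `exp (b η)` is the vertical translation by `a * b`; four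
    -- sides of length `√|r|` give the constant `4 * C`.
    obtain ⟨a, b, hab, ha, hb⟩ : ∃ a b : ℝ, a * b = r ∧ |a| = √|r| ∧ |b| = √|r| := by
      rcases le_total 0 r with h | h
      · refine ⟨√r, √r, Real.mul_self_sqrt h, ?_, ?_⟩ <;>
          rw [abs_of_nonneg h, abs_of_nonneg (Real.sqrt_nonneg _)]
      · refine ⟨√(-r), -√(-r), ?_, ?_, ?_⟩
        · rw [mul_neg, Real.mul_self_sqrt (by linarith)]; ring
        · rw [abs_of_nonpos h, abs_of_nonneg (Real.sqrt_nonneg _)]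
        · rw [abs_of_nonpos h, abs_neg, abs_of_nonneg (Real.sqrt_nonneg _)]
    have e1 := step p a 0
    have e2 := step (p * hor a 0) 0 b
    have e3 := step (p * hor a 0 * hor 0 b) (-a) 0
    have e4 := step (p * hor a 0 * hor 0 b * hor (-a) 0) 0 (-b)
    have hp : p * hor a 0 * hor 0 b * hor (-a) 0 * hor 0 (-b) = p * ⟨0, 0, r⟩ := by
      ext <;> simp; rw [← hab]; ring
    simp only [ne_eq, OfNat.ofNat_ne_zero, not_false_eq_true, zero_pow, add_zero, zero_add, even_two,
      Even.neg_pow, Real.sqrt_sq_eq_abs, ha, hb] at e1 e2 e3 e4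
    rw [hp] at e4
    rw [← dist_eq_norm] at e1 e2 e3 e4 ⊢
    have t1 := dist_triangle (f (p * ⟨0, 0, r⟩)) (f (p * hor a 0 * hor 0 b * hor (-a) 0)) (f p)
    have t2 := dist_triangle (f (p * hor a 0 * hor 0 b * hor (-a) 0)) (f (p * hor a 0 * hor 0 b))
      (f p)
    have t3 := dist_triangle (f (p * hor a 0 * hor 0 b)) (f (p * hor a 0)) (f p)
    linarith
  rw [continuous_iff_continuousAt]
  intro w₀
  set p := coords.symm w₀ with hp
  -- The displacement from `p` factors as a horizontal element followed by a vertical one.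
  let k : ℝ × ℝ × ℝ → Heisenberg := fun w => p⁻¹ * coords.symm w
  have bound : ∀ w, ‖f (coords.symm w) - f p‖ ≤
      4 * C * √|(k w).z| + C * √((k w).x ^ 2 + (k w).y ^ 2) := by
    intro w
    have e1 := step p (k w).x (k w).y
    have e2 := vert (p * hor (k w).x (k w).y) (k w).z
    have hk : p * hor (k w).x (k w).y * ⟨0, 0, (k w).z⟩ = coords.symm w := by
      have : hor (k w).x (k w).y * ⟨0, 0, (k w).z⟩ = k w := by ext <;> simp
      rw [mul_assoc, this]; simp [k]
    rw [hk] at e2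
    rw [← dist_eq_norm] at e1 e2 ⊢
    linarith [dist_triangle (f (coords.symm w)) (f (p * hor (k w).x (k w).y)) (f p)]
  rw [ContinuousAt, ← hp, tendsto_iff_norm_sub_tendsto_zero]
  refine squeeze_zero (fun _ => norm_nonneg _) bound ?_
  have hcont : Continuous fun w : ℝ × ℝ × ℝ =>
      4 * C * √|(k w).z| + C * √((k w).x ^ 2 + (k w).y ^ 2) := by
    simp only [k, coords, Equiv.coe_fn_symm_mk, mul_x, mul_y, mul_z]
    fun_prop
  have h0 : k w₀ = 1 := by simp [k, hp]
  simpa [h0] using hcont.tendsto w₀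

end Heisenberg

/-! ### Radon–Nikodym property and differentiation along curves and flows. -/

/-- A Lipschitz curve on `[0, 1]` is the distribution function of a vector measure. -/
theorem LipschitzWith.exists_vectorMeasure_Ioc {V : Type*} [NormedAddCommGroup V]
    [CompleteSpace V] {φ : ℝ → V} {K : ℝ≥0} (hφ : LipschitzWith K φ) :
    ∃ ν : VectorMeasure ℝ V, (∀ t ∈ Icc (0 : ℝ) 1, ν (Ioc 0 t) = φ t - φ 0) ∧
      ∀ s, ‖ν s‖ₑ ≤ (K • (volume.restrict (Ioc (0 : ℝ) 1)) : Measure ℝ) s := by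
  -- Freezing the curve outside `[0, 1]` makes its increments dominated by a finite measure.
  let ψ : ℝ → V := fun t => φ (max 0 (min t 1))
  have A : ∀ s ∈ {s : Set ℝ | ∃ u v, u ≤ v ∧ s = Ioc u v}, ‖AddContent.onIoc ψ s‖ₑ ≤
      (K • (volume.restrict (Ioc (0 : ℝ) 1)) : Measure ℝ) s := by
    rintro s ⟨u, v, huv, rfl⟩
    rw [AddContent.onIoc_apply huv, ← edist_eq_enorm_sub]
    refine (hφ _ _).trans ?_
    rw [Measure.smul_apply, Measure.restrict_apply measurableSet_Ioc, Ioc_inter_Ioc,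
      Real.volume_Ioc, edist_dist, Real.dist_eq]
    refine mul_le_mul_right (ENNReal.ofReal_le_ofReal_iff'.2 ?_) _
    rcases le_total (max 0 (min v 1) - max 0 (min u 1)) 0 with h | h
    · right
      have : max 0 (min u 1) ≤ max 0 (min v 1) := by gcongr
      rw [abs_of_nonneg] <;> linarith
    · rw [abs_of_nonneg h]
      grind
  have B : (inferInstance : MeasurableSpace ℝ) =
      MeasurableSpace.generateFrom {s | ∃ u v, u ≤ v ∧ s = Ioc u v} := by
    rw [BorelSpace.measurable_eq (α := ℝ)]
    convert! borel_eq_generateFrom_Ioc_le ℝ using 2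
    grind only
  obtain ⟨ν, hν, hν'⟩ :=
    VectorMeasure.exists_extension_of_isSetSemiring_of_le_measure_of_generateFrom
      IsSetSemiring.Ioc A B
  refine ⟨ν, fun t ht => ?_, hν'⟩
  rw [hν _ ⟨0, t, ht.1, rfl⟩, AddContent.onIoc_apply ht.1]
  simp [ψ, ht.1, ht.2]

/-- Lipschitz curves in a space with the Radon-Nikodym property are differentiable almost
everywhere on `[0, 1]`. -/
theorem HasRadonNikodymProperty.ae_differentiableAt {V : Type*} [NormedAddCommGroup V]
    [NormedSpace ℝ V] [CompleteSpace V] (hV : HasRadonNikodymProperty V) {φ : ℝ → V} {K : ℝ≥0}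
    (hφ : LipschitzWith K φ) :
    ∀ᵐ t ∂(volume.restrict (Ioo (0 : ℝ) 1)), DifferentiableAt ℝ φ t := by
  obtain ⟨ν, hν, hν'⟩ := hφ.exists_vectorMeasure_Ioc
  -- Domination by a multiple of Lebesgue measure gives both bounded variation and absolute
  -- continuity.
  obtain ⟨g, hg, hgν⟩ := hV ℝ (volume.restrict (Ioc (0 : ℝ) 1)) ν
    ((ν.variation_apply_le_of_forall_enorm_le MeasurableSet.univ
      (fun E _ _ => hν' E)).trans_lt (measure_lt_top _ _))
    (fun s _ hs => by simpa [hs] using hν' s)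
  have hint : IntervalIntegrable g volume 0 1 :=
    (intervalIntegrable_iff_integrableOn_Ioc_of_le zero_le_one).2 hg
  have key : ∀ t ∈ Icc (0 : ℝ) 1, φ t = φ 0 + ∫ s in (0 : ℝ)..t, g s := by
    intro t ht
    have h := hgν (Ioc 0 t) measurableSet_Ioc
    rw [hν t ht, Measure.restrict_restrict measurableSet_Ioc,
      inter_eq_left.2 (Ioc_subset_Ioc_right ht.2)] at h
    rw [intervalIntegral.integral_of_le ht.1, ← h, add_sub_cancel]
  rw [ae_restrict_iff' measurableSet_Ioo]
  filter_upwards [hint.ae_hasDerivAt_integral] with t ht ht01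
  have ht' := ht (by rw [uIcc_of_le zero_le_one]; exact Ioo_subset_Icc_self ht01) 0 (by simp)
  refine ((ht'.const_add (φ 0)).congr_of_eventuallyEq ?_).differentiableAt
  filter_upwards [Ioo_mem_nhds ht01.1 ht01.2] with s hs
  exact key s (Ioo_subset_Icc_self hs)

/-- If `F` is Lipschitz along the orbits of a measure-preserving flow `T` and takes values in a
space with the Radon-Nikodym property, then its difference quotients along the flow converge
almost everywhere. -/
theorem HasRadonNikodymProperty.ae_cauchySeq_flow {V : Type*} [NormedAddCommGroup V]
    [NormedSpace ℝ V] [CompleteSpace V] (hV : HasRadonNikodymProperty V)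
    {X : Type*} [TopologicalSpace X] [MeasurableSpace X] [OpensMeasurableSpace X]
    {μ : Measure X} [SFinite μ] {T : ℝ → X → X} (hTm : Measurable fun z : X × ℝ => T z.2 z.1)
    (hTc : ∀ t, Continuous (T t)) (hT : ∀ t, MeasurePreserving (T t) μ μ)
    (hadd : ∀ s t x, T s (T t x) = T (t + s) x)
    {F : X → V} (hF : Continuous F) {K : ℝ≥0} (hK : ∀ t x, ‖F (T t x) - F x‖ ≤ K * |t|) :
    ∀ᵐ x ∂μ, CauchySeq fun n : ℕ => ((n : ℝ) + 1) • (F (T (1 / ((n : ℝ) + 1)) x) - F x) := by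
  set D : ℕ → X → V := fun n x => ((n : ℝ) + 1) • (F (T (1 / ((n : ℝ) + 1)) x) - F x) with hD
  have hDc : ∀ n, Continuous (D n) := fun n =>
    ((hF.comp (hTc _)).sub hF).const_smul ((n : ℝ) + 1)
  -- The Cauchy condition is expressed by real-valued distances, so neither separability nor a Borel
  -- structure on `V` is needed.
  have hS : MeasurableSet {x | CauchySeq fun n => D n x} := by
    simp_rw [cauchySeq_iff_tendsto_dist_atTop_0]
    exact measurableSet_tendsto (𝓝 0) fun n : ℕ × ℕ => ((hDc n.1).dist (hDc n.2)).measurable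
  have horbit : ∀ x, ∀ᵐ t ∂(volume.restrict (Ioo (0 : ℝ) 1)), CauchySeq fun n => D n (T t x) := by
    intro x
    have hlip : LipschitzWith K fun t => F (T t x) := by
      refine LipschitzWith.of_dist_le_mul fun s t => ?_
      have := hK (s - t) (T t x)
      rwa [hadd, add_sub_cancel, ← dist_eq_norm, ← Real.dist_eq] at this
    filter_upwards [hV.ae_differentiableAt hlip] with t ht
    have hlim : Tendsto (fun n : ℕ => 1 / ((n : ℝ) + 1)) atTop (𝓝[≠] 0) :=
      tendsto_nhdsWithin_iff.2 ⟨tendsto_one_div_add_atTop_nhds_zero_nat,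
        Eventually.of_forall fun n => by
          simp only [mem_compl_iff, mem_singleton_iff]; positivity⟩
    refine ((ht.hasDerivAt.tendsto_slope_zero.comp hlim).congr fun n => ?_).cauchySeq
    simp [hD, hadd]
  -- By Fubini some single time `t` is good for almost every `x`; invariance of `μ` under `T t` then
  -- removes `t`.
  have hcomm := (Measure.ae_ae_comm (μ := μ) (ν := volume.restrict (Ioo (0 : ℝ) 1))
    (p := fun x t => CauchySeq fun n => D n (T t x)) (hTm hS)).1 (ae_of_all _ horbit)
  have : NeZero (volume.restrict (Ioo (0 : ℝ) 1)) := ⟨by simp⟩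
  obtain ⟨t, ht⟩ := hcomm.exists
  rw [← (hT t).map_eq]
  exact (ae_map_iff (hT t).measurable.aemeasurable hS).2 ht

/-! ### Asymptotic invariance in `L¹`. -/

/-- For a bounded, almost everywhere convergent sequence of continuous functions `G n` and
measure-preserving maps `h n` converging to the identity, `G n ∘ h n` and `G n` are
asymptotically close in `L¹` on bounded sets. -/
theorem tendsto_lintegral_enorm_comp_sub {V : Type*} [NormedAddCommGroup V]
    {X : Type*} [TopologicalSpace X] [MeasurableSpace X] [OpensMeasurableSpace X]
    {μ : Measure X} {G : ℕ → X → V} (hG : ∀ n, Continuous (G n)) {K : ℝ≥0}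
    (hK : ∀ n x, ‖G n x‖ ≤ K) (hcauchy : ∀ᵐ x ∂μ, CauchySeq fun n => G n x)
    {h : ℕ → X → X} (hc : ∀ n, Continuous (h n)) (hmp : ∀ n, MeasurePreserving (h n) μ μ)
    (hlim : ∀ x, Tendsto (fun n => h n x) atTop (𝓝 x))
    {B B' : Set X} (hB' : MeasurableSet B') (hfin : μ B' ≠ ∞)
    (hBB' : B ⊆ B') (hmaps : ∀ n, MapsTo (h n) B B') :
    Tendsto (fun n => ∫⁻ x in B, ‖G n (h n x) - G n x‖ₑ ∂μ) atTop (𝓝 0) := by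
  have hbound : ∀ n m x y, ‖G n x - G m y‖ₑ ≤ ((2 * K : ℝ≥0) : ℝ≥0∞) := by
    intro n m x y
    rw [enorm_le_coe, ← NNReal.coe_le_coe, coe_nnnorm, NNReal.coe_mul, NNReal.coe_ofNat]
    linarith [norm_sub_le (G n x) (G m y), hK n x, hK m y]
  have hpair : Tendsto (fun n : ℕ × ℕ => ∫⁻ x in B', ‖G n.1 x - G n.2 x‖ₑ ∂μ) atTop (𝓝 0) := by
    have := tendsto_lintegral_filter_of_dominated_convergence (μ := μ.restrict B')
      (l := (atTop : Filter (ℕ × ℕ))) (F := fun n x => ‖G n.1 x - G n.2 x‖ₑ) (f := fun _ => 0)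
      (fun _ => ((2 * K : ℝ≥0) : ℝ≥0∞))
      (Eventually.of_forall fun n => ((hG n.1).sub (hG n.2)).enorm.measurable)
      (Eventually.of_forall fun n => ae_of_all _ fun x => hbound _ _ _ _)
      (by
        rw [lintegral_const, Measure.restrict_apply_univ]
        exact ENNReal.mul_ne_top ENNReal.coe_ne_top hfin)
      (by
        filter_upwards [ae_restrict_of_ae hcauchy] with x hx
        have := ENNReal.tendsto_ofReal (cauchySeq_iff_tendsto_dist_atTop_0.1 hx)
        simpa only [dist_eq_norm, ofReal_norm, ENNReal.ofReal_zero] using this)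
    simpa using this
  have hfixed : ∀ m, Tendsto (fun n => ∫⁻ x in B, ‖G m (h n x) - G m x‖ₑ ∂μ) atTop (𝓝 0) := by
    intro m
    have := tendsto_lintegral_filter_of_dominated_convergence (μ := μ.restrict B)
      (l := (atTop : Filter ℕ)) (F := fun n x => ‖G m (h n x) - G m x‖ₑ) (f := fun _ => 0)
      (fun _ => ((2 * K : ℝ≥0) : ℝ≥0∞))
      (Eventually.of_forall fun n => (((hG m).comp (hc n)).sub (hG m)).enorm.measurable)
      (Eventually.of_forall fun n => ae_of_all _ fun x => hbound _ _ _ _)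
      (by
        rw [lintegral_const, Measure.restrict_apply_univ]
        exact ENNReal.mul_ne_top ENNReal.coe_ne_top
          (ne_top_of_le_ne_top hfin (measure_mono hBB')))
      (ae_of_all _ fun x => by
        have := ((((hG m).tendsto x).comp (hlim x)).sub_const (G m x)).enorm
        simpa using this)
    simpa using this
  -- Replace `G n` by a fixed `G m` at both points: the error at `h n x` is moved into `B'` by
  -- measure preservation, and continuity of `G m` handles the rest.
  have htri : ∀ m n, ∫⁻ x in B, ‖G n (h n x) - G n x‖ₑ ∂μ ≤
      2 * ∫⁻ x in B', ‖G n x - G m x‖ₑ ∂μ + ∫⁻ x in B, ‖G m (h n x) - G m x‖ₑ ∂μ := by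
    intro m n
    have hmeas : Measurable fun x => ‖G n x - G m x‖ₑ := ((hG n).sub (hG m)).enorm.measurable
    have hmeas' : Measurable fun x => ‖G m (h n x) - G m x‖ₑ :=
      (((hG m).comp (hc n)).sub (hG m)).enorm.measurable
    have h1 : ∫⁻ x in B, ‖G n (h n x) - G m (h n x)‖ₑ ∂μ ≤ ∫⁻ x in B', ‖G n x - G m x‖ₑ ∂μ := by
      rw [← (hmp n).setLIntegral_comp_preimage hB' hmeas]
      exact lintegral_mono_set (hmaps n)
    have h2 : ∫⁻ x in B, ‖G n x - G m x‖ₑ ∂μ ≤ ∫⁻ x in B', ‖G n x - G m x‖ₑ ∂μ :=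
      lintegral_mono_set hBB'
    calc ∫⁻ x in B, ‖G n (h n x) - G n x‖ₑ ∂μ
        ≤ ∫⁻ x in B, ((‖G n (h n x) - G m (h n x)‖ₑ + ‖G n x - G m x‖ₑ) +
            ‖G m (h n x) - G m x‖ₑ) ∂μ := by
          refine lintegral_mono fun x => ?_
          have : G n (h n x) - G n x = (G n (h n x) - G m (h n x) - (G n x - G m x)) +
              (G m (h n x) - G m x) := by abel
          rw [this]
          exact (enorm_add_le _ _).trans (by gcongr; exact enorm_sub_le)
      _ = (∫⁻ x in B, ‖G n (h n x) - G m (h n x)‖ₑ ∂μ + ∫⁻ x in B, ‖G n x - G m x‖ₑ ∂μ) +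
            ∫⁻ x in B, ‖G m (h n x) - G m x‖ₑ ∂μ := by
          rw [lintegral_add_right _ hmeas', lintegral_add_right _ hmeas]
      _ ≤ _ := by
          rw [two_mul]
          gcongr
  rw [ENNReal.tendsto_nhds_zero]
  intro ε hε
  have hε4 : 0 < ε / 4 := ENNReal.div_pos hε.ne' (by simp)
  have hε2 : 0 < ε / 2 := ENNReal.div_pos hε.ne' (by simp)
  obtain ⟨N, hN⟩ := (ENNReal.tendsto_nhds_zero.1 hpair (ε / 4) hε4).exists_forall_of_atTop
  filter_upwards [ENNReal.tendsto_nhds_zero.1 (hfixed N.2) (ε / 2) hε2,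
    eventually_ge_atTop N.1] with n hn hnN
  refine (htri N.2 n).trans ?_
  calc _ ≤ 2 * (ε / 4) + ε / 2 := by
        gcongr
        exact hN (n, N.2) ⟨hnN, le_rfl⟩
    _ = ε := by
        rw [← mul_div_assoc, show (4 : ℝ≥0∞) = 2 * 2 by norm_num,
          ENNReal.mul_div_mul_left _ _ (by simp) (by simp), ENNReal.add_halves]

/-! ### Right translations and horizontal difference quotients. -/

namespace Heisenberg

/-- Right translation by `h`, in the chart. -/
noncomputable def rightTranslate (h : Heisenberg) (w : ℝ × ℝ × ℝ) : ℝ × ℝ × ℝ := coords (coords.symm w * h)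

theorem rightTranslate_rightTranslate (h k : Heisenberg) (w : ℝ × ℝ × ℝ) :
    rightTranslate k (rightTranslate h w) = rightTranslate (h * k) w := by
  simp [rightTranslate, mul_assoc]

theorem rightTranslate_apply (h : Heisenberg) (w : ℝ × ℝ × ℝ) :
    rightTranslate h w =
      (w.1 + h.x, w.2.1 + h.y, w.2.2 + h.z + (w.1 * h.y - w.2.1 * h.x) / 2) := rfl

theorem continuous_rightTranslate (h : Heisenberg) : Continuous (rightTranslate h) := by
  unfold rightTranslate coords
  simp only [Equiv.coe_fn_mk, Equiv.coe_fn_symm_mk, mul_x, mul_y, mul_z]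
  fun_prop

/-- Lebesgue measure in the chart is right-invariant. -/
theorem measurePreserving_rightTranslate (h : Heisenberg) :
    MeasurePreserving (rightTranslate h) volume volume := by
  -- Right translation is triangular: each coordinate is shifted by an amount depending only on the
  -- earlier ones.
  have hfiber : ∀ x : ℝ, MeasurePreserving
      (fun v : ℝ × ℝ => (v.1 + h.y, v.2 + (h.z + (x * h.y - v.1 * h.x) / 2))) volume volume := by
    intro x
    exact (measurePreserving_add_right volume h.y).skew_product
      (g := fun y z => z + (h.z + (x * h.y - y * h.x) / 2))
      (by unfold Function.uncurry; fun_prop)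
      (ae_of_all _ fun y => map_add_right_eq_self volume _)
  have hskew : MeasurePreserving (fun w : ℝ × ℝ × ℝ => (w.1 + h.x,
      (w.2.1 + h.y, w.2.2 + (h.z + (w.1 * h.y - w.2.1 * h.x) / 2)))) volume volume :=
    (measurePreserving_add_right volume h.x).skew_product
      (g := fun (x : ℝ) (v : ℝ × ℝ) => (v.1 + h.y, v.2 + (h.z + (x * h.y - v.1 * h.x) / 2)))
      (by unfold Function.uncurry; fun_prop)
      (ae_of_all _ fun x => (hfiber x).map_eq)
  convert hskew using 2 with w
  rw [rightTranslate_apply, add_assoc w.2.2]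

/-- The difference quotient of `F` over the step `1 / (n + 1)` in the direction `u ξ + v η`. -/
noncomputable def horQuotient {V : Type*} [AddCommGroup V] [Module ℝ V] (F : ℝ × ℝ × ℝ → V) (u v : ℝ) (n : ℕ)
    (w : ℝ × ℝ × ℝ) : V :=
  ((n : ℝ) + 1) •
    (F (rightTranslate (hor (1 / ((n : ℝ) + 1) * u) (1 / ((n : ℝ) + 1) * v)) w) - F w)

section Quotient

variable {V : Type*} [NormedAddCommGroup V] [NormedSpace ℝ V] {F : ℝ × ℝ × ℝ → V} {C : ℝ≥0}

theorem continuous_horQuotient (hF : Continuous F) (u v : ℝ) (n : ℕ) :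
    Continuous (horQuotient F u v n) :=
  ((hF.comp (continuous_rightTranslate _)).sub hF).const_smul ((n : ℝ) + 1)

theorem norm_horQuotient_le
    (hC : ∀ u v w, ‖F (rightTranslate (hor u v) w) - F w‖ ≤ C * √(u ^ 2 + v ^ 2))
    {u v : ℝ} (huv : u ^ 2 + v ^ 2 = 1) (n : ℕ) (w : ℝ × ℝ × ℝ) :
    ‖horQuotient F u v n w‖ ≤ C := by
  have hn : (0 : ℝ) < (n : ℝ) + 1 := by positivity
  have h := hC (1 / ((n : ℝ) + 1) * u) (1 / ((n : ℝ) + 1) * v) w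
  rw [mul_pow, mul_pow, ← mul_add, huv, mul_one, Real.sqrt_sq (by positivity)] at h
  rw [horQuotient, norm_smul, Real.norm_of_nonneg hn.le]
  calc _ ≤ ((n : ℝ) + 1) * (C * (1 / ((n : ℝ) + 1))) := by gcongr
    _ = C := by field_simp

/-- Right translations by multiples of one horizontal vector form a measure-preserving flow, along
which `F` is `C`-Lipschitz because the vector has unit length. -/
theorem ae_cauchySeq_horQuotient [CompleteSpace V] (hV : HasRadonNikodymProperty V)
    (hF : Continuous F)
    (hC : ∀ u v w, ‖F (rightTranslate (hor u v) w) - F w‖ ≤ C * √(u ^ 2 + v ^ 2))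
    {u v : ℝ} (huv : u ^ 2 + v ^ 2 = 1) :
    ∀ᵐ w, CauchySeq fun n => horQuotient F u v n w := by
  refine hV.ae_cauchySeq_flow (T := fun t => rightTranslate (hor (t * u) (t * v))) (K := C)
    ?_ (fun t => continuous_rightTranslate _) (fun t => measurePreserving_rightTranslate _)
    (fun s t w => ?_) hF (fun t w => ?_)
  · simp only [rightTranslate_apply, hor_x, hor_y, hor_z]
    fun_prop
  · simp only [rightTranslate_rightTranslate]
    congr 1
    ext <;> simp <;> ring
  · have h := hC (t * u) (t * v) w
    rwa [mul_pow, mul_pow, ← mul_add, huv, mul_one, Real.sqrt_sq_eq_abs] at h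

end Quotient

/-- The quadrilateral with sides `s ξ`, `s η`, `-s ξ`, `-s η`, where `s = 1 / (n + 1)`, closes up to
the vertical translation by `s ^ 2`. -/
theorem smul_vertical_sub_eq {V : Type*} [AddCommGroup V] [Module ℝ V] (F : ℝ × ℝ × ℝ → V) (n : ℕ)
    (w : ℝ × ℝ × ℝ) {s : ℝ} (hs : s = 1 / ((n : ℝ) + 1)) :
    ((n : ℝ) + 1) • (F (rightTranslate ⟨0, 0, s ^ 2⟩ w) - F w) =
      horQuotient F 0 1 n (rightTranslate (hor s 0) w) - horQuotient F 0 1 n w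
      - (horQuotient F 1 0 n (rightTranslate ⟨0, s, s ^ 2⟩ w) - horQuotient F 1 0 n w)
      - (horQuotient F 0 1 n (rightTranslate ⟨0, 0, s ^ 2⟩ w) - horQuotient F 0 1 n w) := by
  -- These identities match the endpoints of the sides. The two `η`-sides are compared through the
  -- `η`-quotient at `w`, which accounts for the third difference.
  have e1 : (⟨0, s, s ^ 2⟩ : Heisenberg) * hor s 0 = hor s 0 * hor 0 s := by
    ext <;> simp; ring
  have e2 : (⟨0, 0, s ^ 2⟩ : Heisenberg) * hor 0 s = ⟨0, s, s ^ 2⟩ := by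
    ext <;> simp
  simp only [horQuotient, ← hs, mul_zero, mul_one, rightTranslate_rightTranslate, e1, e2]
  module

end Heisenberg

/-! ### The contradiction. -/

open Heisenberg in
theorem mainTheorem3 (V : Type*) [NormedAddCommGroup V] [NormedSpace ℝ V] [CompleteSpace V]
    (hV : HasRadonNikodymProperty V) :
    ¬ ∃ f : Heisenberg → V, Heisenberg.IsBilipschitzEmbedding f := by
  rintro ⟨f, c, C, hc, hf⟩
  set F : ℝ × ℝ × ℝ → V := fun w => f (coords.symm w) with hFdef
  have hF : Continuous F := continuous_comp_coords_symm fun p q => (hf p q).2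
  have hC : ∀ u v w, ‖F (rightTranslate (hor u v) w) - F w‖ ≤ C * √(u ^ 2 + v ^ 2) := by
    intro u v w
    simpa [hFdef, rightTranslate] using
      norm_sub_le_of_edist_le (fun p q => (hf p q).2) (coords.symm w) u v
  let B : Set (ℝ × ℝ × ℝ) := Icc (0, 0, 0) (1, 1, 1)
  -- The translations used below move points of `B` to coordinates of size at most `3`; `5` leaves
  -- room.
  let B' : Set (ℝ × ℝ × ℝ) := Icc (-5, -5, -5) (5, 5, 5)
  have hfin : volume B' ≠ ∞ := isCompact_Icc.measure_lt_top.ne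
  let s : ℕ → ℝ := fun n => 1 / ((n : ℝ) + 1)
  have hs : Tendsto s atTop (𝓝 0) := tendsto_one_div_add_atTop_nhds_zero_nat
  have hs0 : ∀ n, 0 < s n := fun n => by positivity
  have hs1 : ∀ n, s n ≤ 1 := fun n => by
    rw [div_le_one (by positivity)]; linarith [n.cast_nonneg (α := ℝ)]
  -- The parameters `α`, `β`, `δ` cover the three translations in `smul_vertical_sub_eq` at once.
  have key : ∀ (u v α β δ : ℝ), u ^ 2 + v ^ 2 = 1 → |α| ≤ 1 → |β| ≤ 1 → |δ| ≤ 1 →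
      Tendsto (fun n => ∫⁻ w in B, ‖horQuotient F u v n
        (rightTranslate ⟨α * s n, β * s n, δ * s n ^ 2⟩ w) - horQuotient F u v n w‖ₑ)
        atTop (𝓝 0) := by
    intro u v α β δ huv hα hβ hδ
    refine tendsto_lintegral_enorm_comp_sub (continuous_horQuotient hF u v)
      (norm_horQuotient_le hC huv) (ae_cauchySeq_horQuotient hV hF hC huv)
      (fun n => continuous_rightTranslate _) (fun n => measurePreserving_rightTranslate _)
      (fun w => ?_) (measurableSet_Icc : MeasurableSet B') hfin
      (Icc_subset_Icc ⟨by norm_num, by norm_num, by norm_num⟩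
        ⟨by norm_num, by norm_num, by norm_num⟩) (fun n w hw => ?_)
    · have hcont : Continuous fun r : ℝ => rightTranslate ⟨α * r, β * r, δ * r ^ 2⟩ w := by
        simp only [rightTranslate_apply]
        fun_prop
      simpa [rightTranslate_apply, Function.comp_def] using (hcont.tendsto 0).comp hs
    · obtain ⟨⟨hx0, hy0, hz0⟩, hx1, hy1, hz1⟩ := hw
      simp only at hx0 hy0 hz0 hx1 hy1 hz1
      have ha : |α * s n| ≤ 1 := by
        rw [abs_mul, abs_of_pos (hs0 n)]
        exact mul_le_one₀ hα (hs0 n).le (hs1 n)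
      have hb : |β * s n| ≤ 1 := by
        rw [abs_mul, abs_of_pos (hs0 n)]
        exact mul_le_one₀ hβ (hs0 n).le (hs1 n)
      have hd : |δ * s n ^ 2| ≤ 1 := by
        rw [abs_mul, abs_of_pos (pow_pos (hs0 n) 2)]
        exact mul_le_one₀ hδ (pow_pos (hs0 n) 2).le (pow_le_one₀ (hs0 n).le (hs1 n))
      have hab : |w.1 * (β * s n)| ≤ 1 := by
        rw [abs_mul, abs_of_nonneg hx0]; exact mul_le_one₀ hx1 (abs_nonneg _) hb
      have hba : |w.2.1 * (α * s n)| ≤ 1 := by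
        rw [abs_mul, abs_of_nonneg hy0]; exact mul_le_one₀ hy1 (abs_nonneg _) ha
      rw [abs_le] at ha hb hd hab hba
      rw [rightTranslate_apply]
      refine ⟨⟨?_, ?_, ?_⟩, ?_, ?_, ?_⟩ <;> simp only <;> linarith
  have hlow : ∀ n w, (c : ℝ≥0∞) ≤
      ‖horQuotient F 0 1 n (rightTranslate ⟨1 * s n, 0 * s n, 0 * s n ^ 2⟩ w)
        - horQuotient F 0 1 n w‖ₑ +
      ‖horQuotient F 1 0 n (rightTranslate ⟨0 * s n, 1 * s n, 1 * s n ^ 2⟩ w)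
        - horQuotient F 1 0 n w‖ₑ +
      ‖horQuotient F 0 1 n (rightTranslate ⟨0 * s n, 0 * s n, 1 * s n ^ 2⟩ w)
        - horQuotient F 0 1 n w‖ₑ := by
    intro n w
    have h1 : (c : ℝ≥0∞) * ENNReal.ofReal (s n) ≤
        ‖F (rightTranslate ⟨0, 0, s n ^ 2⟩ w) - F w‖ₑ := by
      refine (mul_le_mul_right (ofReal_le_carnotDist (coords.symm w) (s n)) _).trans
        ((hf _ _).1.trans ?_)
      rw [edist_comm, edist_eq_enorm_sub]
      simp [hFdef, rightTranslate]
    have h2 : (c : ℝ≥0∞) ≤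
        ‖((n : ℝ) + 1) • (F (rightTranslate ⟨0, 0, s n ^ 2⟩ w) - F w)‖ₑ := by
      have hn : ‖(n : ℝ) + 1‖ₑ * ENNReal.ofReal (s n) = 1 := by
        rw [Real.enorm_of_nonneg (by positivity), ← ENNReal.ofReal_mul (by positivity),
          mul_one_div_cancel (by positivity), ENNReal.ofReal_one]
      calc (c : ℝ≥0∞) = ‖(n : ℝ) + 1‖ₑ * (c * ENNReal.ofReal (s n)) := by
            rw [mul_left_comm, hn, mul_one]
        _ ≤ _ := by rw [enorm_smul]; gcongr
    rw [smul_vertical_sub_eq F n w rfl] at h2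
    refine h2.trans (enorm_sub_le.trans ?_)
    simp only [one_mul, zero_mul]
    gcongr
    exact enorm_sub_le
  have hsum := ((key 0 1 1 0 0 (by norm_num) (by norm_num) (by norm_num) (by norm_num)).add
    (key 1 0 0 1 1 (by norm_num) (by norm_num) (by norm_num) (by norm_num))).add
    (key 0 1 0 0 1 (by norm_num) (by norm_num) (by norm_num) (by norm_num))
  -- Integrate the pointwise lower bound `hlow` over `B` and let `n` tend to infinity.
  have hle : (c : ℝ≥0∞) * volume B ≤ 0 + 0 + 0 := by
    refine ge_of_tendsto' hsum fun n => ?_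
    have hmeas : ∀ u v k, Measurable fun w =>
        ‖horQuotient F u v n (rightTranslate k w) - horQuotient F u v n w‖ₑ := fun u v k =>
      (((continuous_horQuotient hF u v n).comp (continuous_rightTranslate k)).sub
        (continuous_horQuotient hF u v n)).enorm.measurable
    rw [← lintegral_add_right _ (hmeas _ _ _), ← lintegral_add_right _ (hmeas _ _ _),
      ← setLIntegral_const]
    exact lintegral_mono fun w => hlow n w
  have hB : volume B = 1 := by
    simp only [B, ← Icc_prod_Icc, Measure.volume_eq_prod, Measure.prod_prod, Real.volume_Icc]
    simp
  simp [hB, hc.ne'] at hle
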